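/- Let $q$ be an odd prime power. For $F, x \in \mathbb{F}_q[T]$ with $F \neq 0$, let $\deg_F x$ denote the degree of the unique $x' \in \mathbb{F}_q[T]$ with $\deg x' < \deg F$ and $x' \equiv x \pmod F$, where $\deg 0 = -\infty$. For an integer $m \ge 0$ let $E_{F,2}^{\sqrt{}}(\mathbf{1}_m)$ be the number of $4$-tuples $(x_1,x_2,x_3,x_4)$ of polynomials in $\mathbb{F}_q[T]$ of degree less than $\deg F$ such that $x_1+x_2 \equiv x_3+x_4 \pmod F$ and $\deg_F(x_i^2) < m$ for $i=1,2,3,4$. Then there is a function $g=g_q : \mathbb{Z}_{\ge 0} \to \mathbb{R}$, depending only on $q$, with $g(m) = o(m)$ as $m \to \infty$, such that for every irreducible $F \in \mathbb{F}_q[T]$, with $r = \deg F$, and every integer $m$ with $0 \le m \le r$, $$E_{F,2}^{\sqrt{}}(\mathbf{1}_m) \le q^{g(m)}\left(q^{7m/2-r/2} + q^{2m}\right).$$ -/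

import Mathlib

open Polynomial Filter Asymptotics

/-- `degMod F x` is `deg_F x`: the degree of the residue of `x` modulo `F` of degree less than
`deg F`, with the convention `deg 0 = ⊥` (that is, `-∞`). -/
noncomputable def degMod {K : Type*} [Field K] (F x : K[X]) : WithBot ℕ :=
  (x % F).degree

/-- `degMod F x` is the degree of any `x'` with `deg x' < deg F` and `x' ≡ x mod F`. -/
theorem degMod_eq_degree {K : Type*} [Field K] {F x x' : K[X]}
    (hdeg : x'.degree < F.degree) (hmod : F ∣ x' - x) : degMod F x = x'.degree := by
  have h : x' % F = x % F := by
    rw [← sub_eq_zero, ← Polynomial.sub_mod]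
    exact (EuclideanDomain.mod_eq_zero).2 hmod
  have hx' : x' % F = x' := (Polynomial.mod_eq_self_iff (by rintro rfl; simp at hdeg)).2 hdeg
  rw [degMod, ← h, hx']

/-- The quadruples `(x₁, x₂, x₃, x₄)` (indexed from `0`) of polynomials of degree less than `deg F`
with `x₁ + x₂ ≡ x₃ + x₄ mod F` and `deg_F (xᵢ ^ 2) < m` for every `i`. -/
def modularRootQuadruples {K : Type*} [Field K] (F : K[X]) (m : ℕ) : Set (Fin 4 → K[X]) :=
  {x | (∀ i, (x i).degree < F.degree) ∧ (∀ i, degMod F (x i ^ 2) < (m : WithBot ℕ)) ∧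
    F ∣ (x 0 + x 1) - (x 2 + x 3)}

/-- Over a finite field there are only finitely many such quadruples, so that their number
is meaningful as the natural number `Set.ncard`. -/
theorem modularRootQuadruples_finite {K : Type*} [Field K] [Finite K] (F : K[X]) (m : ℕ) :
    (modularRootQuadruples F m).Finite := by
  have hfin : {p : K[X] | p.degree < F.degree}.Finite := by
    have : Finite (degreeLT K F.natDegree) :=
      Finite.of_equiv _ (degreeLTEquiv K F.natDegree).symm.toEquiv
    refine (Set.toFinite (degreeLT K F.natDegree : Set K[X])).subset fun p hp => ?_
    exact mem_degreeLT.2 (lt_of_lt_of_le hp degree_le_natDegree)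
  exact (Set.Finite.pi' fun _ : Fin 4 => hfin).subset fun x hx => hx.1

/-- The additive energy of modular square roots: the number of quadruples of residues modulo `F`
with `x₁ + x₂ ≡ x₃ + x₄ mod F` and `deg_F (xᵢ ^ 2) < m`. -/
noncomputable def modularRootEnergy {K : Type*} [Field K] (F : K[X]) (m : ℕ) : ℕ :=
  (modularRootQuadruples F m).ncard

/-! The energy is at most the sum over shifts l of P(l)^2, where P(l) counts the x for which x and x
+ l both have squares of residue degree < m; moreover ∑ P(l) ≤ 4q^(2m). For l ≠ 0 let u and v be the
residues of (x+l)^2 - x^2 and (x+l)^2 + x^2. Both have degree < m, u determines x, and u^2 - 2l^2 v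
+ l^4 ≡ 0 mod F, so P(l) counts points of a parabola in a small box.

By pigeonhole 2l^2 ≡ c/a with a, c coprime, the degrees being balanced so that the difference of two
points gives a(u^2 - u₀^2) - c(v - v₀) = F z with deg z < Z, where Z is max(0, (3m - r)/2) up to
rounding. Fix z and a point with first coordinate b. Then c divides (u - b)(u + b), so a
factorisation c = d e places u in a class modulo lcm(d, e), while (u^2 - b^2)/c has degree < m - deg
a, so u is close to b or -b. A large s = gcd(d, e) weakens the congruence, but it forces s^2 ∣ z -
z' and leaves fewer values of z.

Hence (`card_le_of_parabola`), up to divisor functions, either P(l) is at most q^Z, and such l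
contribute q^Z ∑ P(l), or P(l)^2 is at most a sum of weights of (a, c). Since (a, c) determines l up
to sign, these weights can be summed over all pairs (`sum_commonDivisorWeight_sq_le`). Both cases
give q^(2m+Z), and the divisor function costs q^(o(m)). -/

/-! ### Counting polynomials, and the divisor bound. -/

section CountingPolynomials

open scoped Classical

variable {K : Type*} [Field K] [Fintype K]

/-- The polynomials of degree less than `n`. -/
noncomputable def polyBall (K : Type*) [Field K] [Fintype K] (n : ℕ) : Finset K[X] :=
  have : Finite (degreeLT K n) := Finite.of_equiv _ (degreeLTEquiv K n).symm.toEquiv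
  (Set.toFinite (degreeLT K n : Set K[X])).toFinset

theorem mem_polyBall {n : ℕ} {x : K[X]} : x ∈ polyBall K n ↔ x.degree < n := by
  simp [polyBall, mem_degreeLT]

theorem card_polyBall (n : ℕ) : (polyBall K n).card = Fintype.card K ^ n := by
  have : Finite (degreeLT K n) := Finite.of_equiv _ (degreeLTEquiv K n).symm.toEquiv
  have h : (polyBall K n).card = Nat.card (degreeLT K n) := by
    exact (Set.ncard_eq_toFinset_card _ _).symm
  rw [h, Nat.card_congr (degreeLTEquiv K n).toEquiv]
  simp

theorem mem_polyBall_of_ne_zero {n : ℕ} {x : K[X]} (hx : x ≠ 0) :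
    x ∈ polyBall K n ↔ x.natDegree < n := by
  rw [mem_polyBall, natDegree_lt_iff_degree_lt hx]

/-- Polynomials that lie in one residue class modulo `d` and differ by polynomials of degree less
than `n`. -/
theorem card_le_of_dvd_sub {W : Finset K[X]} {d : K[X]} (hd : d ≠ 0) {n : ℕ}
    (hdvd : ∀ u ∈ W, ∀ u' ∈ W, d ∣ u - u') (hdeg : ∀ u ∈ W, ∀ u' ∈ W, (u - u').degree < n) :
    W.card ≤ Fintype.card K ^ (n - d.natDegree) := by
  rcases W.eq_empty_or_nonempty with rfl | ⟨u₀, hu₀⟩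
  · simp
  rw [← card_polyBall]
  have key : ∀ u ∈ W, d * ((u - u₀) / d) = u - u₀ := fun u hu =>
    EuclideanDomain.mul_div_cancel' hd (hdvd u hu u₀ hu₀)
  refine Finset.card_le_card_of_injOn (fun u => (u - u₀) / d) (fun u hu => ?_) ?_
  · have h1 := key u hu
    have h2 := hdeg u hu u₀ hu₀
    simp only [Finset.mem_coe]
    generalize (u - u₀) / d = y at *
    by_cases hy : y = 0
    · simp [mem_polyBall, hy, bot_lt_iff_ne_bot]
    · rw [mem_polyBall_of_ne_zero hy]
      rw [← h1, ← natDegree_lt_iff_degree_lt (mul_ne_zero hd hy), natDegree_mul hd hy] at h2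
      omega
  · intro u hu u' hu' h
    have h1 := key u hu
    have h2 := key u' hu'
    simp only at h
    rw [h, h2] at h1
    exact (sub_left_injective h1).symm

theorem sum_card_pow_neg_natDegree_le (n : ℕ) :
    ∑ a ∈ (polyBall K n).erase 0, ((Fintype.card K : ℝ) ^ a.natDegree)⁻¹ ≤
      Fintype.card K * n := by
  have hq : (0 : ℝ) < Fintype.card K := by exact_mod_cast Fintype.card_pos
  have hmaps : ∀ a ∈ (polyBall K n).erase 0, a.natDegree ∈ Finset.range n := by
    intro a ha
    rw [Finset.mem_erase] at ha
    exact Finset.mem_range.2 ((mem_polyBall_of_ne_zero ha.1).1 ha.2)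
  rw [← Finset.sum_fiberwise_of_maps_to hmaps]
  have : ∀ j ∈ Finset.range n,
      ∑ a ∈ (polyBall K n).erase 0 with a.natDegree = j, ((Fintype.card K : ℝ) ^ a.natDegree)⁻¹
        ≤ Fintype.card K := by
    intro j _
    have h1 : ((polyBall K n).erase 0).filter (fun a => a.natDegree = j) ⊆ polyBall K (j + 1) := by
      intro a ha
      simp only [Finset.mem_filter, Finset.mem_erase] at ha
      rw [mem_polyBall_of_ne_zero ha.1.1]
      omega
    have h2 := Finset.card_le_card h1
    rw [card_polyBall] at h2
    calc _ = ∑ a ∈ (polyBall K n).erase 0 with a.natDegree = j, ((Fintype.card K : ℝ) ^ j)⁻¹ :=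
          Finset.sum_congr rfl fun a ha => by rw [(Finset.mem_filter.1 ha).2]
      _ = (((polyBall K n).erase 0).filter (fun a => a.natDegree = j)).card *
            ((Fintype.card K : ℝ) ^ j)⁻¹ := by simp
      _ ≤ (Fintype.card K : ℝ) ^ (j + 1) * ((Fintype.card K : ℝ) ^ j)⁻¹ := by
          gcongr
          exact_mod_cast h2
      _ = Fintype.card K := by
          rw [pow_succ, mul_comm, inv_mul_cancel_left₀ (pow_pos hq j).ne']
  calc _ ≤ ∑ j ∈ Finset.range n, (Fintype.card K : ℝ) := Finset.sum_le_sum this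
    _ = _ := by simp [mul_comm]

/-- The divisors of `f`, units included. -/
noncomputable def polyDivisors (f : K[X]) : Finset K[X] :=
  (polyBall K (f.natDegree + 1)).filter (· ∣ f)

theorem mem_polyDivisors {f d : K[X]} (hf : f ≠ 0) : d ∈ polyDivisors f ↔ d ∣ f := by
  rw [polyDivisors, Finset.mem_filter, and_iff_right_iff_imp]
  intro h
  rw [mem_polyBall_of_ne_zero (ne_zero_of_dvd_ne_zero hf h)]
  exact Nat.lt_succ_of_le (natDegree_le_of_dvd h hf)

-- A divisor is determined by its leading coefficient and its multiset of monic irreducible factors,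
-- a submultiset of that of `f`.
open UniqueFactorizationMonoid in
theorem card_polyDivisors_le_prod {f : K[X]} (hf : f ≠ 0) :
    (polyDivisors f).card ≤ Fintype.card K *
      ∏ p ∈ (normalizedFactors f).toFinset, ((normalizedFactors f).count p + 1) := by
  rw [← Multiset.card_Iic, ← Finset.card_univ, ← Finset.card_product]
  refine Finset.card_le_card_of_injOn (fun d => (d.leadingCoeff, normalizedFactors d))
    (fun d hd => ?_) ?_
  · have hd' := (mem_polyDivisors hf).1 hd
    simpa using (dvd_iff_normalizedFactors_le_normalizedFactors
      (ne_zero_of_dvd_ne_zero hf hd') hf).1 hd'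
  · intro d hd e he h
    have hd0 := ne_zero_of_dvd_ne_zero hf ((mem_polyDivisors hf).1 hd)
    have he0 := ne_zero_of_dvd_ne_zero hf ((mem_polyDivisors hf).1 he)
    simp only [Prod.mk.injEq] at h
    have h1 := prod_normalizedFactors_eq hd0
    have h2 := prod_normalizedFactors_eq he0
    rw [h.2, h2] at h1
    have h3 : ∀ x : K[X], x ≠ 0 → normalize x * C x.leadingCoeff = x := by
      intro x hx
      have := leadingCoeff_ne_zero.2 hx
      rw [normalize_apply, coe_normUnit_of_ne_zero hx, mul_assoc, ← C_mul,
        inv_mul_cancel₀ this, C_1, mul_one]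
    rw [← h3 d hd0, ← h3 e he0, h.1, h1]

open UniqueFactorizationMonoid in
theorem sum_count_mul_natDegree {K : Type*} [Field K] {f : K[X]} (hf : f ≠ 0) :
    ∑ p ∈ (normalizedFactors f).toFinset, (normalizedFactors f).count p * p.natDegree =
      f.natDegree := by
  have h := natDegree_multiset_prod (normalizedFactors f) (zero_notMem_normalizedFactors f)
  rw [Finset.sum_multiset_map_count] at h
  simp only [smul_eq_mul] at h
  rw [← h]
  exact natDegree_eq_of_degree_eq (degree_eq_degree_of_associated (prod_normalizedFactors hf))

-- Fewer than q^(D+1) primes have degree at most `D`, and each gives a factor at most n + 1. For the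
-- others count + 1 ≤ 2^count, and their counts add up to at most n/(D+1).
open UniqueFactorizationMonoid in
theorem card_polyDivisors_le {f : K[X]} (hf : f ≠ 0) {n : ℕ} (hn : f.natDegree ≤ n) (D : ℕ) :
    (polyDivisors f).card ≤
      Fintype.card K * ((n + 1) ^ (Fintype.card K ^ (D + 1)) * 2 ^ (n / (D + 1))) := by
  refine (card_polyDivisors_le_prod hf).trans (Nat.mul_le_mul_left _ ?_)
  set N := normalizedFactors f with hN
  have hsum := sum_count_mul_natDegree hf
  rw [← hN] at hsum
  rw [← Finset.prod_filter_mul_prod_filter_not N.toFinset (fun p => p.natDegree ≤ D)]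
  have hpos : ∀ p ∈ N.toFinset, p ≠ 0 ∧ 0 < p.natDegree := by
    intro p hp
    have := irreducible_of_normalized_factor p (Multiset.mem_toFinset.1 hp)
    exact ⟨this.ne_zero, this.natDegree_pos⟩
  refine Nat.mul_le_mul ?_ ?_
  · calc _ ≤ ∏ p ∈ N.toFinset with p.natDegree ≤ D, (n + 1) := by
          refine Finset.prod_le_prod' fun p hp => ?_
          rw [Finset.mem_filter] at hp
          have h1 := Finset.single_le_sum (f := fun p => N.count p * p.natDegree)
            (fun _ _ => Nat.zero_le _) hp.1
          have h2 := Nat.le_mul_of_pos_right (N.count p) (hpos p hp.1).2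
          omega
      _ = (n + 1) ^ (N.toFinset.filter (fun p => p.natDegree ≤ D)).card := by simp
      _ ≤ _ := by
          refine Nat.pow_le_pow_right (Nat.succ_pos _) ?_
          rw [← card_polyBall]
          refine Finset.card_le_card fun p hp => ?_
          rw [Finset.mem_filter] at hp
          rw [mem_polyBall_of_ne_zero (hpos p hp.1).1]
          omega
  · calc _ ≤ ∏ p ∈ N.toFinset with ¬ p.natDegree ≤ D, 2 ^ N.count p :=
          Finset.prod_le_prod' fun p _ => Nat.lt_two_pow_self
      _ = 2 ^ ∑ p ∈ N.toFinset with ¬ p.natDegree ≤ D, N.count p := Finset.prod_pow_eq_pow_sum ..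
      _ ≤ _ := by
          refine Nat.pow_le_pow_right two_pos ?_
          rw [Nat.le_div_iff_mul_le (Nat.succ_pos _), Finset.sum_mul]
          calc _ ≤ ∑ p ∈ N.toFinset with ¬ p.natDegree ≤ D, N.count p * p.natDegree := by
                refine Finset.sum_le_sum fun p hp => Nat.mul_le_mul_left _ ?_
                rw [Finset.mem_filter] at hp
                omega
            _ ≤ ∑ p ∈ N.toFinset, N.count p * p.natDegree :=
                Finset.sum_le_sum_of_subset (Finset.filter_subset _ _)
            _ ≤ n := hsum.trans_le hn

/-- The largest number of divisors of a nonzero polynomial of degree less than `n`. -/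
noncomputable def maxDivisors (K : Type*) [Field K] [Fintype K] (n : ℕ) : ℕ :=
  ((polyBall K n).erase 0).sup fun f => (polyDivisors f).card

theorem card_polyDivisors_le_maxDivisors {f : K[X]} (hf : f ≠ 0) {n : ℕ} (hn : f.natDegree < n) :
    (polyDivisors f).card ≤ maxDivisors K n :=
  Finset.le_sup (f := fun f : K[X] => (polyDivisors f).card)
    (Finset.mem_erase.2 ⟨hf, (mem_polyBall_of_ne_zero hf).2 hn⟩)

theorem maxDivisors_le (n D : ℕ) : maxDivisors K n ≤
    Fintype.card K * ((n + 1) ^ (Fintype.card K ^ (D + 1)) * 2 ^ (n / (D + 1))) := by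
  refine Finset.sup_le fun f hf => ?_
  rw [Finset.mem_erase] at hf
  exact card_polyDivisors_le hf.1 ((mem_polyBall_of_ne_zero hf.1).1 hf.2).le D

end CountingPolynomials

/-! ### Small ratios modulo F, and squares in a residue class. -/

section Parabola

open scoped Classical

/-- Every residue modulo `F` is a ratio of coprime polynomials of small degree. -/
theorem exists_isCoprime_dvd_sub_mul {K : Type*} [Field K] [Finite K] {F t : K[X]}
    (hF : Irreducible F) (ht : ¬ F ∣ t) {A C : ℕ} (hA : A ≤ F.natDegree) (hC : C ≤ F.natDegree)
    (hAC : F.natDegree < A + C) :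
    ∃ a c : K[X], a ≠ 0 ∧ c ≠ 0 ∧ IsCoprime a c ∧ a.natDegree < A ∧ c.natDegree < C ∧
      F ∣ c - t * a := by
  have := Fintype.ofFinite K
  -- Pigeonhole: there are q^(A+C) pairs (a, c) and only q^(deg F) residues c - t a. The common
  -- factor of a and c is removed afterwards.
  obtain ⟨x, hx, y, hy, hxy, h⟩ := Finset.exists_ne_map_eq_of_card_lt_of_maps_to
    (s := polyBall K A ×ˢ polyBall K C) (t := polyBall K F.natDegree)
    (f := fun x => (x.2 - t * x.1) % F) (by
      rw [Finset.card_product, card_polyBall, card_polyBall, card_polyBall, ← pow_add]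
      exact Nat.pow_lt_pow_right Fintype.one_lt_card hAC) (by
      intro x _
      simp only [Finset.mem_coe]
      rw [mem_polyBall, ← degree_eq_natDegree hF.ne_zero]
      exact degree_mod_lt _ hF.ne_zero)
  simp only [Finset.mem_product, mem_polyBall] at hx hy
  obtain ⟨a, haA, hadef⟩ : ∃ a : K[X], a.degree < A ∧ a = x.1 - y.1 :=
    ⟨_, (degree_sub_le _ _).trans_lt (max_lt hx.1 hy.1), rfl⟩
  obtain ⟨c, hcC, hcdef⟩ : ∃ c : K[X], c.degree < C ∧ c = x.2 - y.2 :=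
    ⟨_, (degree_sub_le _ _).trans_lt (max_lt hx.2 hy.2), rfl⟩
  have hdvd : F ∣ c - t * a := by
    have h1 := EuclideanDomain.mod_eq_zero.1 (show (x.2 - t * x.1 - (y.2 - t * y.1)) % F = 0 by
      rw [Polynomial.sub_mod]; exact sub_eq_zero.2 h)
    convert h1 using 1
    rw [hcdef, hadef]; ring
  have hsmall : ∀ {x : K[X]} {n : ℕ}, x.degree < n → n ≤ F.natDegree → F ∣ x → x = 0 :=
    fun hx hn h => eq_zero_of_dvd_of_degree_lt h (hx.trans_le (by
      rw [degree_eq_natDegree hF.ne_zero]; exact_mod_cast hn))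
  have ha : a ≠ 0 := by
    rintro rfl
    have hc := hsmall hcC hC (by simpa using hdvd)
    exact hxy (Prod.ext (sub_eq_zero.1 hadef.symm) (sub_eq_zero.1 (hcdef.symm.trans hc)))
  have hFa : ¬ F ∣ a := fun h => ha (hsmall haA hA h)
  have hc : c ≠ 0 := by
    rintro rfl
    rw [zero_sub, dvd_neg, hF.prime.dvd_mul] at hdvd
    tauto
  obtain ⟨a', ha'⟩ := EuclideanDomain.gcd_dvd_left a c
  obtain ⟨c', hc'⟩ := EuclideanDomain.gcd_dvd_right a c
  have hbez := EuclideanDomain.gcd_eq_gcd_ab a c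
  set g := EuclideanDomain.gcd a c
  have hg : g ≠ 0 := by
    intro h
    rw [h, zero_mul] at ha'
    exact ha ha'
  have ha0 : a' ≠ 0 := by rintro rfl; simp [ha] at ha'
  have hc0 : c' ≠ 0 := by rintro rfl; simp [hc] at hc'
  refine ⟨a', c', ha0, hc0, ?_, ?_, ?_, ?_⟩
  · refine ⟨EuclideanDomain.gcdA a c, EuclideanDomain.gcdB a c, mul_left_cancel₀ hg ?_⟩
    linear_combination -hbez - EuclideanDomain.gcdA a c * ha' - EuclideanDomain.gcdB a c * hc'
  · rw [← natDegree_lt_iff_degree_lt ha] at haA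
    exact (natDegree_le_of_dvd ⟨g, by rw [ha', mul_comm]⟩ ha).trans_lt haA
  · rw [← natDegree_lt_iff_degree_lt hc] at hcC
    exact (natDegree_le_of_dvd ⟨g, by rw [hc', mul_comm]⟩ hc).trans_lt hcC
  · have h1 : F ∣ g * (c' - t * a') := by
      convert hdvd using 1
      linear_combination t * ha' - hc'
    exact (hF.prime.dvd_mul.1 h1).resolve_left fun h => hFa (h.trans (EuclideanDomain.gcd_dvd_left a c))

/-- A bound for the number of `u` with `u ^ 2` close to a given square and in a given class modulo
`c`, where `δ` is the sum of the degrees of `a` and `c`. -/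
def squareClassBound (q m δ σ : ℕ) : ℕ :=
  if δ + 1 ≤ m + 2 * σ then q ^ ((m + 2 * σ + 1 - δ) / 2) else 0

variable {K : Type*} [Field K] [Fintype K]

/-- All u agree modulo lcm(c₁, c₂), of degree deg(c₁c₂) - σ with σ the degree of the gcd, and all
lie within degree (m + deg(c₁c₂) - deg a - 1)/2 of `b`. If the modulus has larger degree than this
radius, at most one u survives: that is the zero branch of `squareClassBound`. -/
theorem card_le_one_add_squareClassBound {a c₁ c₂ b u₁ : K[X]} {m : ℕ} {W : Finset K[X]}
    (ha : a ≠ 0) (hc₁ : c₁ ≠ 0) (hc₂ : c₂ ≠ 0)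
    (hW : ∀ u ∈ W, c₁ ∣ u - u₁ ∧ c₂ ∣ u + u₁ ∧ ∃ k, (a * k).degree < m ∧
      (u - b).degree + (u - b).degree ≤ (c₁ * c₂ * k).degree) :
    W.card ≤ 1 + squareClassBound (Fintype.card K) m (a.natDegree + (c₁ * c₂).natDegree)
      (EuclideanDomain.gcd c₁ c₂).natDegree := by
  by_cases hone : W.card ≤ 1
  · omega
  have hdist : ∀ u ∈ W, u = b ∨
      2 * (u - b).natDegree + a.natDegree + 1 ≤ m + (c₁ * c₂).natDegree := by
    intro u hu
    obtain ⟨-, -, k, hk, hk'⟩ := hW u hu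
    rw [or_iff_not_imp_left]
    intro hub
    have hub' := sub_ne_zero.2 hub
    have hk0 : k ≠ 0 := by
      rintro rfl
      rw [degree_eq_natDegree hub'] at hk'
      simp at hk'
    rw [← natDegree_lt_iff_degree_lt (mul_ne_zero ha hk0), natDegree_mul ha hk0] at hk
    rw [degree_eq_natDegree hub', degree_eq_natDegree (mul_ne_zero (mul_ne_zero hc₁ hc₂) hk0),
      natDegree_mul (mul_ne_zero hc₁ hc₂) hk0] at hk'
    norm_cast at hk'
    omega
  have hdiff : ∀ u ∈ W, ∀ u' ∈ W, u ≠ u' →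
      2 * (u - u').natDegree + a.natDegree + 1 ≤ m + (c₁ * c₂).natDegree := by
    intro u hu u' hu' hne
    rcases hdist u hu with h | h <;> rcases hdist u' hu' with h' | h'
    · exact absurd (h.trans h'.symm) hne
    · rwa [h, ← neg_sub, natDegree_neg]
    · rwa [h']
    · have h1 := natDegree_sub_le (u - b) (u' - b)
      rw [sub_sub_sub_cancel_right] at h1
      rcases le_max_iff.1 h1 with h2 | h2 <;> omega
  have hlcm : ∀ u ∈ W, ∀ u' ∈ W, EuclideanDomain.lcm c₁ c₂ ∣ u - u' := by
    intro u hu u' hu'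
    obtain ⟨h1, h2, -⟩ := hW u hu
    obtain ⟨h1', h2', -⟩ := hW u' hu'
    exact EuclideanDomain.lcm_dvd (by simpa using dvd_sub h1 h1') (by simpa using dvd_sub h2 h2')
  have hl0 : EuclideanDomain.lcm c₁ c₂ ≠ 0 := by simp [EuclideanDomain.lcm_eq_zero_iff, hc₁, hc₂]
  have hg0 : EuclideanDomain.gcd c₁ c₂ ≠ 0 := by simp [EuclideanDomain.gcd_eq_zero_iff, hc₁]
  have hdeg : (c₁ * c₂).natDegree = (EuclideanDomain.gcd c₁ c₂).natDegree +
      (EuclideanDomain.lcm c₁ c₂).natDegree := by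
    rw [← natDegree_mul hg0 hl0, EuclideanDomain.gcd_mul_lcm]
  obtain ⟨u, hu, u', hu', hne⟩ := Finset.one_lt_card.1 (not_le.1 hone)
  have h1 := hdiff u hu u' hu' hne
  have h2 := natDegree_le_of_dvd (hlcm u hu u' hu') (sub_ne_zero.2 hne)
  rw [squareClassBound, if_pos (by omega)]
  refine (card_le_of_dvd_sub hl0 (n := (m + (c₁ * c₂).natDegree - a.natDegree - 1) / 2 + 1) hlcm
    fun u hu u' hu' => ?_).trans ?_
  · by_cases h : u = u'
    · simp [h, bot_lt_iff_ne_bot]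
    · rw [← natDegree_lt_iff_degree_lt (sub_ne_zero.2 h)]
      have := hdiff u hu u' hu' h
      omega
  · refine le_add_left (Nat.pow_le_pow_right Fintype.card_pos ?_)
    omega

end Parabola

/-! ### Points of a parabola modulo F in a small box. -/

section Concentration

theorem degree_mul_lt_add {R : Type*} [Semiring R] {x y : R[X]} {m n : ℕ} (hx : x.degree < m)
    (hy : y.degree < n) : (x * y).degree < (m + n : ℕ) := by
  by_cases hx0 : x = 0
  · simp [hx0, bot_lt_iff_ne_bot]
  by_cases hy0 : y = 0
  · simp [hy0, bot_lt_iff_ne_bot]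
  rw [degree_eq_natDegree hx0] at hx
  rw [degree_eq_natDegree hy0] at hy
  refine (degree_mul_le x y).trans_lt ?_
  rw [degree_eq_natDegree hx0, degree_eq_natDegree hy0]
  norm_cast at hx hy ⊢
  omega

theorem exists_mul_of_mul_eq_mul {R : Type*} [CommRing R] [IsDomain R] {a c x y : R} (hc : c ≠ 0)
    (hac : IsCoprime a c) (h : a * x = c * y) : ∃ k, x = c * k ∧ y = a * k := by
  obtain ⟨k, rfl⟩ := hac.symm.dvd_of_dvd_mul_left (Dvd.intro _ h.symm)
  refine ⟨k, rfl, mul_left_cancel₀ hc ?_⟩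
  linear_combination -h

theorem dvd_div_gcd_of_dvd_mul {R : Type*} [EuclideanDomain R] [DecidableEq R] {c x y : R}
    (hc : c ≠ 0) (h : c ∣ x * y) : c / EuclideanDomain.gcd c x ∣ y := by
  obtain ⟨c', hc'⟩ := EuclideanDomain.gcd_dvd_left c x
  have hbez := EuclideanDomain.gcd_eq_gcd_ab c x
  obtain ⟨k, hk⟩ := h
  have hg : EuclideanDomain.gcd c x ≠ 0 := by
    intro h
    rw [h, zero_mul] at hc'
    exact hc hc'
  have hdiv : c / EuclideanDomain.gcd c x = c' := by
    nth_rewrite 1 [hc']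
    exact mul_div_cancel_left₀ c' hg
  rw [hdiv]
  refine ⟨EuclideanDomain.gcdA c x * y + EuclideanDomain.gcdB c x * k, mul_left_cancel₀ hg ?_⟩
  linear_combination y * hbez + EuclideanDomain.gcdB c x * hk +
    (EuclideanDomain.gcdA c x * y + EuclideanDomain.gcdB c x * k) * hc'

open scoped Classical

variable {K : Type*} [Field K] [Fintype K]

/-- The weight attached to a common divisor `s` of the two parts of `c`. -/
noncomputable def commonDivisorWeight (m Z : ℕ) (a c s : K[X]) : ℕ :=
  Fintype.card K ^ (Z - 2 * s.natDegree) *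
    squareClassBound (Fintype.card K) m (a.natDegree + c.natDegree) s.natDegree

/-- The zero branch of `squareClassBound` confines a and s to degrees below `m`, which makes the
later sum over (a, c, s) finite and short. -/
theorem commonDivisorWeight_ne_zero {m Z : ℕ} {a c s : K[X]} (hc : c ≠ 0) (hs : s ^ 2 ∣ c)
    (hcm : c.natDegree < 2 * m) (h : commonDivisorWeight m Z a c s ≠ 0) :
    s.natDegree < m ∧ a.natDegree < m := by
  have h1 := natDegree_le_of_dvd hs hc
  rw [natDegree_pow] at h1
  have h2 : a.natDegree + c.natDegree + 1 ≤ m + 2 * s.natDegree := by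
    by_contra h3
    simp [commonDivisorWeight, squareClassBound, h3] at h
  omega

theorem card_le_of_parabola {F a c t w : K[X]} (hF : Irreducible F) (h2 : (2 : K) ≠ 0) {m Z : ℕ}
    (ha : a ≠ 0) (hc : c ≠ 0) (hac : IsCoprime a c) (hFc : ¬ F ∣ c) (hct : F ∣ c - t * a)
    (haZ : a.natDegree + 2 * m ≤ F.natDegree + Z) (hcZ : c.natDegree + m ≤ F.natDegree + Z)
    {U : Finset K[X]} (hU : ∀ u ∈ U, u.degree < m ∧ ∃ v : K[X], v.degree < m ∧
      F ∣ u ^ 2 - t * v + w) :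
    U.card ≤ 4 * (maxDivisors K (2 * m) + 1) * Fintype.card K ^ Z ∨
      (c.natDegree < 2 * m ∧ a.natDegree < m ∧
        U.card ^ 2 ≤ 16 * maxDivisors K (2 * m) ^ 2 *
          ∑ s ∈ (polyBall K m).erase 0 with s ^ 2 ∣ c, commonDivisorWeight m Z a c s ^ 2) := by
  rcases U.eq_empty_or_nonempty with rfl | ⟨u₀, hu₀⟩
  · simp
  have hF0 := hF.ne_zero
  have h2' : IsUnit (2 : K[X]) := by
    rw [show (2 : K[X]) = C 2 from (map_ofNat C 2).symm]
    exact isUnit_C.2 h2.isUnit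
  choose! hum v hv hFv using hU
  have hsq : ∀ u ∈ U, ∀ u' ∈ U, (u ^ 2 - u' ^ 2).degree < (2 * m : ℕ) := by
    intro u hu u' hu'
    rw [sq_sub_sq, two_mul]
    exact degree_mul_lt_add ((degree_add_le _ _).trans_lt (max_lt (hum u hu) (hum u' hu')))
      ((degree_sub_le _ _).trans_lt (max_lt (hum u hu) (hum u' hu')))
  -- Subtracting two points removes `w`; multiplying by `a` replaces `t` by `c`.
  have hz : ∀ u ∈ U, ∃ z, a * (u ^ 2 - u₀ ^ 2) - c * (v u - v u₀) = F * z := by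
    intro u hu
    have h1 : a * (u ^ 2 - u₀ ^ 2) - c * (v u - v u₀) =
      a * ((u ^ 2 - t * v u + w) - (u₀ ^ 2 - t * v u₀ + w)) - (c - t * a) * (v u - v u₀) := by ring
    rw [h1]
    exact dvd_sub ((dvd_sub (hFv u hu) (hFv u₀ hu₀)).mul_left _) (hct.mul_right _)
  choose! z hz using hz
  have hvsub : ∀ u ∈ U, ∀ u' ∈ U, (v u - v u').degree < m := fun u hu u' hu' =>
    (degree_sub_le _ _).trans_lt (max_lt (hv u hu) (hv u' hu'))
  have hzdeg : ∀ u ∈ U, z u ∈ polyBall K Z := by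
    intro u hu
    by_cases hz0 : z u = 0
    · simp [hz0, mem_polyBall, bot_lt_iff_ne_bot]
    have h1 : (F * z u).degree < (F.natDegree + Z : ℕ) := by
      rw [← hz u hu]
      refine (degree_sub_le _ _).trans_lt (max_lt ?_ ?_)
      · by_cases h : u ^ 2 - u₀ ^ 2 = 0
        · simp [h, bot_lt_iff_ne_bot]
        · have := hsq u hu u₀ hu₀
          rw [← natDegree_lt_iff_degree_lt h] at this
          rw [← natDegree_lt_iff_degree_lt (mul_ne_zero ha h), natDegree_mul ha h]
          omega
      · by_cases h : v u - v u₀ = 0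
        · simp [h, bot_lt_iff_ne_bot]
        · have := hvsub u hu u₀ hu₀
          rw [← natDegree_lt_iff_degree_lt h] at this
          rw [← natDegree_lt_iff_degree_lt (mul_ne_zero hc h), natDegree_mul hc h]
          omega
    rw [← natDegree_lt_iff_degree_lt (mul_ne_zero hF0 hz0), natDegree_mul hF0 hz0] at h1
    rw [mem_polyBall_of_ne_zero hz0]
    omega
  -- One base point is chosen for each value of z. Comparing u with the base point of the same z
  -- cancels the multiple of F and leaves an exact equation.
  have hbase : ∀ y ∈ U.image z, ∃ u ∈ U, z u = y := fun y hy => Finset.mem_image.1 hy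
  choose! base hbaseU hbasez using hbase
  replace hbaseU : ∀ u ∈ U, base (z u) ∈ U := fun u hu => hbaseU _ (Finset.mem_image_of_mem z hu)
  replace hbasez : ∀ u ∈ U, z (base (z u)) = z u := fun u hu =>
    hbasez _ (Finset.mem_image_of_mem z hu)
  have hk : ∀ u ∈ U, ∃ k, u ^ 2 - base (z u) ^ 2 = c * k ∧ v u - v (base (z u)) = a * k := by
    intro u hu
    refine exists_mul_of_mul_eq_mul hc hac ?_
    have h1 := hz _ (hbaseU u hu)
    rw [hbasez u hu] at h1
    linear_combination hz u hu - h1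
  by_cases hcm : c.natDegree < 2 * m
  swap
  · left
    -- Here the difference of squares is a multiple of `c` of degree < 2m ≤ deg c, so it vanishes.
    have hsq0 : ∀ u ∈ U, u = base (z u) ∨ u = -base (z u) := by
      intro u hu
      obtain ⟨k, hk, -⟩ := hk u hu
      refine sq_eq_sq_iff_eq_or_eq_neg.1 (sub_eq_zero.1 ?_)
      by_contra h
      have h1 := hsq u hu _ (hbaseU u hu)
      rw [← natDegree_lt_iff_degree_lt h] at h1
      exact hcm ((natDegree_le_of_dvd ⟨k, hk⟩ h).trans_lt h1)
    have h1 : U.card ≤ 2 * (U.image z).card := by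
      refine Finset.card_le_mul_card_image U 2 fun y _ => ?_
      refine (Finset.card_le_card (t := {base y, -base y}) fun u hu => ?_).trans
        Finset.card_le_two
      obtain ⟨hu', rfl⟩ := Finset.mem_filter.1 hu
      simpa using hsq0 u hu'
    have h2 : (U.image z).card ≤ Fintype.card K ^ Z := by
      rw [← card_polyBall]
      exact Finset.card_le_card (Finset.image_subset_iff.2 hzdeg)
    calc U.card ≤ 2 * Fintype.card K ^ Z := h1.trans (Nat.mul_le_mul_left 2 h2)
      _ ≤ _ := by gcongr; omega
  -- With b the base point, u is sorted by d = gcd(c, u - b) and by which of u - b, u + b has the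
  -- smaller degree; `ε` thus records whether u is compared with b or with -b.
  have hclass : ∀ d ∈ polyDivisors c, ∀ ε : Prop,
      (U.filter fun u => EuclideanDomain.gcd c (u - base (z u)) = d ∧
        ((u - base (z u)).degree ≤ (u + base (z u)).degree ↔ ε)).card ≤
      Fintype.card K ^ Z + commonDivisorWeight m Z a c (EuclideanDomain.gcd d (c / d)) := by
    intro d hd ε
    rw [mem_polyDivisors hc] at hd
    obtain ⟨e, rfl⟩ := hd
    have hd0 : d ≠ 0 := left_ne_zero_of_mul hc
    have he0 : e ≠ 0 := right_ne_zero_of_mul hc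
    rw [mul_div_cancel_left₀ e hd0]
    set W := U.filter fun u => EuclideanDomain.gcd (d * e) (u - base (z u)) = d ∧
        ((u - base (z u)).degree ≤ (u + base (z u)).degree ↔ ε) with hW
    set s := EuclideanDomain.gcd d e with hs
    have hs0 : s ≠ 0 := by simp [hs, EuclideanDomain.gcd_eq_zero_iff, hd0]
    have hsd : s ∣ d := EuclideanDomain.gcd_dvd_left d e
    have hse : s ∣ e := EuclideanDomain.gcd_dvd_right d e
    have hWU : ∀ u ∈ W, u ∈ U := fun u hu => (Finset.mem_filter.1 hu).1
    have hd_dvd : ∀ u ∈ W, d ∣ u - base (z u) := by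
      intro u hu
      have h1 := EuclideanDomain.gcd_dvd_right (d * e) (u - base (z u))
      rwa [(Finset.mem_filter.1 hu).2.1] at h1
    have he_dvd : ∀ u ∈ W, e ∣ u + base (z u) := by
      intro u hu
      obtain ⟨k, hk, -⟩ := hk u (hWU u hu)
      have h1 := dvd_div_gcd_of_dvd_mul (c := d * e) (x := u - base (z u)) (y := u + base (z u))
        hc ⟨k, by rw [← hk]; ring⟩
      rwa [(Finset.mem_filter.1 hu).2.1, mul_div_cancel_left₀ e hd0] at h1
    -- s divides u - b and u + b, hence 2b, and 2 is a unit.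
    have hs_base : ∀ u ∈ W, s ∣ base (z u) := by
      intro u hu
      have h1 := dvd_sub (hse.trans (he_dvd u hu)) (hsd.trans (hd_dvd u hu))
      rw [add_sub_sub_cancel, ← two_mul] at h1
      exact (h2'.dvd_mul_left).1 h1
    have hFs : IsCoprime F (s ^ 2) := by
      refine (hF.coprime_iff_not_dvd.2 fun h => hFc ?_).pow_right
      exact h.trans (hsd.mul_right e)
    -- s^2 divides the squares of the base points and also c = d e, hence F(z - z'); and F is
    -- coprime to s.
    have hz_dvd : ∀ u ∈ W, ∀ u' ∈ W, s ^ 2 ∣ z u - z u' := by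
      intro u hu u' hu'
      have h1 := hz _ (hbaseU u (hWU u hu))
      have h1' := hz _ (hbaseU u' (hWU u' hu'))
      rw [hbasez u (hWU u hu)] at h1
      rw [hbasez u' (hWU u' hu')] at h1'
      refine hFs.symm.dvd_of_dvd_mul_left (y := F) ?_
      have h3 : F * (z u - z u') = a * (base (z u) ^ 2 - base (z u') ^ 2) -
          d * e * (v (base (z u)) - v (base (z u'))) := by
        linear_combination h1' - h1
      rw [h3]
      refine dvd_sub (Dvd.dvd.mul_left (dvd_sub ?_ ?_) a) (Dvd.dvd.mul_right ?_ _)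
      · exact pow_dvd_pow_of_dvd (hs_base u hu) 2
      · exact pow_dvd_pow_of_dvd (hs_base u' hu') 2
      · rw [pow_two]; exact mul_dvd_mul hsd hse
    have himage : (W.image z).card ≤ Fintype.card K ^ (Z - 2 * s.natDegree) := by
      rw [← natDegree_pow]
      refine card_le_of_dvd_sub (pow_ne_zero 2 hs0) ?_ ?_
      · simp only [Finset.forall_mem_image]
        exact hz_dvd
      · simp only [Finset.forall_mem_image]
        intro u hu u' hu'
        exact (degree_sub_le _ _).trans_lt (max_lt (mem_polyBall.1 (hzdeg u (hWU u hu)))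
          (mem_polyBall.1 (hzdeg u' (hWU u' hu'))))
    have hfiber : ∀ y ∈ W.image z, (W.filter fun u => z u = y).card ≤
        1 + squareClassBound (Fintype.card K) m (a.natDegree + (d * e).natDegree) s.natDegree := by
      intro y _
      refine card_le_one_add_squareClassBound (u₁ := base y) (b := if ε then base y else -base y)
        ha hd0 he0 fun u hu => ?_
      obtain ⟨hyp, rfl⟩ := Finset.mem_filter.1 hu
      obtain ⟨k, hk, hk'⟩ := hk u (hWU u hyp)
      refine ⟨hd_dvd u hyp, he_dvd u hyp, k, ?_, ?_⟩
      · rw [← hk']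
        exact hvsub u (hWU u hyp) _ (hbaseU u (hWU u hyp))
      · rw [← hk, show u ^ 2 - base (z u) ^ 2 = (u - base (z u)) * (u + base (z u)) by ring,
          degree_mul]
        have hε := (Finset.mem_filter.1 hyp).2.2
        by_cases h : ε
        · rw [if_pos h]
          exact add_le_add le_rfl (hε.2 h)
        · rw [if_neg h, sub_neg_eq_add]
          exact add_le_add (not_le.1 (mt hε.1 h)).le le_rfl
    calc W.card ≤ _ := Finset.card_le_mul_card_image W _ hfiber
      _ ≤ (1 + squareClassBound (Fintype.card K) m (a.natDegree + (d * e).natDegree)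
            s.natDegree) * Fintype.card K ^ (Z - 2 * s.natDegree) := Nat.mul_le_mul_left _ himage
      _ = Fintype.card K ^ (Z - 2 * s.natDegree) + commonDivisorWeight m Z a (d * e) s := by
          rw [commonDivisorWeight]; ring
      _ ≤ _ := by
          gcongr
          · exact Fintype.card_pos
          · omega
  have hcard : U.card ≤ 2 * ((polyDivisors c).card * Fintype.card K ^ Z) +
      2 * ∑ d ∈ polyDivisors c, commonDivisorWeight m Z a c (EuclideanDomain.gcd d (c / d)) := by
    have hmaps : Set.MapsTo (fun u => (EuclideanDomain.gcd c (u - base (z u)),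
        ((u - base (z u)).degree ≤ (u + base (z u)).degree))) (U : Set K[X])
        (polyDivisors c ×ˢ (Finset.univ : Finset Prop) : Finset (K[X] × Prop)) := by
      intro u _
      simp only [Finset.coe_product, Set.mem_prod, Finset.mem_coe, Finset.mem_univ, and_true]
      exact (mem_polyDivisors hc).2 (EuclideanDomain.gcd_dvd_left _ _)
    rw [Finset.card_eq_sum_card_fiberwise hmaps, Finset.sum_product]
    calc _ ≤ ∑ d ∈ polyDivisors c, ∑ _ε : Prop, (Fintype.card K ^ Z +
            commonDivisorWeight m Z a c (EuclideanDomain.gcd d (c / d))) := by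
          refine Finset.sum_le_sum fun d hd => Finset.sum_le_sum fun ε _ => ?_
          refine le_trans (Finset.card_le_card fun u hu => ?_) (hclass d hd ε)
          simpa [Prod.ext_iff] using hu
      _ = _ := by
          simp only [Finset.sum_const, Finset.card_univ, Fintype.card_prop, smul_eq_mul,
            ← Finset.mul_sum, Finset.sum_add_distrib]
          ring
  have hT : (polyDivisors c).card ≤ maxDivisors K (2 * m) :=
    card_polyDivisors_le_maxDivisors hc hcm
  set f := fun s => commonDivisorWeight m Z a c s with hf
  set T := maxDivisors K (2 * m) with hTdef
  -- Whichever of the two terms of `hcard` dominates decides the alternative. In the second,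
  -- Cauchy–Schwarz costs one divisor count, and replacing each square by the sum over all s costs
  -- another.
  by_cases hcase : ∑ d ∈ polyDivisors c, f (EuclideanDomain.gcd d (c / d)) ≤
      (polyDivisors c).card * Fintype.card K ^ Z
  · left
    calc U.card ≤ 4 * ((polyDivisors c).card * Fintype.card K ^ Z) := by
          simp only [hf] at hcase
          omega
      _ ≤ 4 * ((T + 1) * Fintype.card K ^ Z) := by gcongr; omega
      _ = _ := by ring
  right
  rw [not_le] at hcase
  have hsqdvd : ∀ d ∈ polyDivisors c, EuclideanDomain.gcd d (c / d) ^ 2 ∣ c := by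
    intro d hd
    rw [mem_polyDivisors hc] at hd
    rw [pow_two]
    nth_rewrite 3 [← EuclideanDomain.mul_div_cancel' (ne_zero_of_dvd_ne_zero hc hd) hd]
    exact mul_dvd_mul (EuclideanDomain.gcd_dvd_left _ _) (EuclideanDomain.gcd_dvd_right _ _)
  obtain ⟨d, hd, hd0⟩ := Finset.exists_ne_zero_of_sum_ne_zero (Nat.ne_zero_of_lt hcase)
  refine ⟨hcm, (commonDivisorWeight_ne_zero hc (hsqdvd d hd) hcm hd0).2, ?_⟩
  have hterm : ∀ d ∈ polyDivisors c, f (EuclideanDomain.gcd d (c / d)) ^ 2 ≤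
      ∑ s ∈ (polyBall K m).erase 0 with s ^ 2 ∣ c, f s ^ 2 := by
    intro d hd
    by_cases h0 : f (EuclideanDomain.gcd d (c / d)) = 0
    · simp [h0]
    · refine Finset.single_le_sum (f := fun s => f s ^ 2) (fun _ _ => Nat.zero_le _) ?_
      have hs0 : EuclideanDomain.gcd d (c / d) ≠ 0 :=
        ne_zero_of_dvd_ne_zero hc ((dvd_pow_self _ two_ne_zero).trans (hsqdvd d hd))
      rw [Finset.mem_filter, Finset.mem_erase, mem_polyBall_of_ne_zero hs0]
      exact ⟨⟨hs0, (commonDivisorWeight_ne_zero hc (hsqdvd d hd) hcm h0).1⟩, hsqdvd d hd⟩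
  calc U.card ^ 2 ≤ (4 * ∑ d ∈ polyDivisors c, f (EuclideanDomain.gcd d (c / d))) ^ 2 := by
        refine Nat.pow_le_pow_left ?_ 2
        simp only [hf] at hcase ⊢
        omega
    _ = 16 * (∑ d ∈ polyDivisors c, f (EuclideanDomain.gcd d (c / d))) ^ 2 := by ring
    _ ≤ 16 * ((polyDivisors c).card *
          ∑ d ∈ polyDivisors c, f (EuclideanDomain.gcd d (c / d)) ^ 2) := by
        gcongr
        exact sq_sum_le_card_mul_sum_sq
    _ ≤ 16 * (T * (T * ∑ s ∈ (polyBall K m).erase 0 with s ^ 2 ∣ c, f s ^ 2)) := by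
        gcongr
        calc _ ≤ ∑ d ∈ polyDivisors c, _ := Finset.sum_le_sum hterm
          _ = (polyDivisors c).card * _ := by rw [Finset.sum_const, smul_eq_mul]
          _ ≤ _ := by gcongr
    _ = _ := by ring

end Concentration

/-! ### Summing the weights, and reduction of the energy to parabolas. -/

section Energy

open scoped Classical

variable {K : Type*} [Field K] [Fintype K]

/-- With σ = deg s the exponent on the left is at most 2(Z - 2σ) + m + 1 + σ, the subtraction being
truncated. `Z ≤ m` settles 2σ ≤ Z, and σ < m settles the rest. The spare powers of q make the sums
over a, s and e cost only a factor of order m each. -/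
theorem commonDivisorWeight_sq_mul_le {m Z : ℕ} (hZ : Z ≤ m) {a s e : K[X]} (hs : s ≠ 0)
    (he : e ≠ 0) (hsm : s.natDegree < m) :
    commonDivisorWeight m Z a (s ^ 2 * e) s ^ 2 *
      (Fintype.card K ^ a.natDegree * (Fintype.card K ^ s.natDegree *
        Fintype.card K ^ e.natDegree)) ≤ Fintype.card K ^ (2 * m + Z + 1) := by
  rw [commonDivisorWeight, natDegree_mul (pow_ne_zero 2 hs) he, natDegree_pow, squareClassBound]
  split_ifs with h
  · rw [← pow_add, ← pow_add, ← pow_add, ← pow_mul, ← pow_add]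
    refine Nat.pow_le_pow_right Fintype.card_pos ?_
    omega
  · simp

theorem sum_commonDivisorWeight_sq_le {m Z : ℕ} (hZ : Z ≤ m) :
    ∑ a ∈ (polyBall K m).erase 0, ∑ c ∈ (polyBall K (2 * m)).erase 0,
      ∑ s ∈ (polyBall K m).erase 0 with s ^ 2 ∣ c, (commonDivisorWeight m Z a c s : ℝ) ^ 2 ≤
    2 * (m : ℝ) ^ 3 * (Fintype.card K : ℝ) ^ (2 * m + Z + 4) := by
  set q : ℝ := (Fintype.card K : ℝ) with hqdef
  have hq : 0 < q := by
    rw [hqdef]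
    exact_mod_cast Fintype.card_pos
  have h1 : ∀ a ∈ (polyBall K m).erase 0, ∑ c ∈ (polyBall K (2 * m)).erase 0,
      ∑ s ∈ (polyBall K m).erase 0 with s ^ 2 ∣ c, (commonDivisorWeight m Z a c s : ℝ) ^ 2 ≤
      ∑ s ∈ (polyBall K m).erase 0, ∑ e ∈ (polyBall K (2 * m)).erase 0,
        q ^ (2 * m + Z + 1) * ((q ^ a.natDegree)⁻¹ * ((q ^ s.natDegree)⁻¹ *
          (q ^ e.natDegree)⁻¹)) := by
    intro a _
    rw [Finset.sum_comm' (t' := (polyBall K m).erase 0)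
      (s' := fun s => ((polyBall K (2 * m)).erase 0).filter (fun c => s ^ 2 ∣ c))
      (by intro x y; simp only [Finset.mem_filter]; tauto)]
    refine Finset.sum_le_sum fun s hs => ?_
    rw [Finset.mem_erase] at hs
    have hsm := (mem_polyBall_of_ne_zero hs.1).1 hs.2
    have hs2 := pow_ne_zero 2 hs.1
    have hsub : ((polyBall K (2 * m)).erase 0).filter (fun c => s ^ 2 ∣ c) ⊆
        ((polyBall K (2 * m)).erase 0).image (fun e => s ^ 2 * e) := by
      intro c hc
      rw [Finset.mem_filter, Finset.mem_erase] at hc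
      obtain ⟨⟨hc0, hcm⟩, e, rfl⟩ := hc
      have he0 := right_ne_zero_of_mul hc0
      refine Finset.mem_image.2 ⟨e, ?_, rfl⟩
      rw [mem_polyBall_of_ne_zero hc0, natDegree_mul hs2 he0] at hcm
      rw [Finset.mem_erase, mem_polyBall_of_ne_zero he0]
      exact ⟨he0, by omega⟩
    refine (Finset.sum_le_sum_of_subset_of_nonneg hsub fun _ _ _ => sq_nonneg _).trans ?_
    rw [Finset.sum_image fun x _ y _ h => mul_left_cancel₀ hs2 h]
    refine Finset.sum_le_sum fun e he => ?_
    rw [← mul_inv, ← mul_inv, ← div_eq_mul_inv, le_div_iff₀ (by positivity)]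
    have := commonDivisorWeight_sq_mul_le hZ (a := a) hs.1 (Finset.mem_erase.1 he).1 hsm
    rw [hqdef]
    exact_mod_cast this
  refine (Finset.sum_le_sum h1).trans ?_
  simp only [← Finset.mul_sum, ← Finset.sum_mul]
  have hm := sum_card_pow_neg_natDegree_le (K := K) m
  have h2m := sum_card_pow_neg_natDegree_le (K := K) (2 * m)
  rw [← hqdef] at hm h2m
  calc _ ≤ q ^ (2 * m + Z + 1) * ((q * m) * ((q * m) * (q * (2 * m : ℕ)))) := by gcongr
    _ = _ := by push_cast; ring

/-- The residues modulo `F` whose square has a residue of degree less than `m`. -/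
noncomputable def smallSquareRoots (F : K[X]) (m : ℕ) : Finset K[X] :=
  (polyBall K F.natDegree).filter fun x => degMod F (x ^ 2) < m

theorem eq_of_dvd_sub_of_mem_polyBall {F x y : K[X]} (hF : F ≠ 0)
    (hx : x ∈ polyBall K F.natDegree) (hy : y ∈ polyBall K F.natDegree) (h : F ∣ x - y) :
    x = y := by
  rw [mem_polyBall, ← degree_eq_natDegree hF] at hx hy
  exact sub_eq_zero.1 (eq_zero_of_dvd_of_degree_lt h
    ((degree_sub_le _ _).trans_lt (max_lt hx hy)))

theorem neg_mem_polyBall {n : ℕ} {x : K[X]} (hx : x ∈ polyBall K n) : -x ∈ polyBall K n := by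
  rwa [mem_polyBall, degree_neg, ← mem_polyBall]

theorem add_mem_polyBall {n : ℕ} {x y : K[X]} (hx : x ∈ polyBall K n) (hy : y ∈ polyBall K n) :
    x + y ∈ polyBall K n :=
  mem_polyBall.2 ((degree_add_le _ _).trans_lt (max_lt (mem_polyBall.1 hx) (mem_polyBall.1 hy)))

theorem sub_mem_polyBall {n : ℕ} {x y : K[X]} (hx : x ∈ polyBall K n) (hy : y ∈ polyBall K n) :
    x - y ∈ polyBall K n := by
  rw [sub_eq_add_neg]
  exact add_mem_polyBall hx (neg_mem_polyBall hy)

theorem eq_or_eq_neg_of_dvd_sq_sub_sq {F x y : K[X]} (hF : Irreducible F)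
    (hx : x ∈ polyBall K F.natDegree) (hy : y ∈ polyBall K F.natDegree)
    (h : F ∣ x ^ 2 - y ^ 2) : x = y ∨ x = -y := by
  rw [sq_sub_sq, hF.prime.dvd_mul] at h
  rcases h with h | h
  · exact .inr (eq_of_dvd_sub_of_mem_polyBall hF.ne_zero hx (neg_mem_polyBall hy)
      (by rwa [sub_neg_eq_add]))
  · exact .inl (eq_of_dvd_sub_of_mem_polyBall hF.ne_zero hx hy h)

theorem dvd_mod_sub {K : Type*} [Field K] (F x : K[X]) : F ∣ x % F - x :=
  ⟨-(x / F), by linear_combination EuclideanDomain.div_add_mod x F⟩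

theorem card_smallSquareRoots_le {F : K[X]} (hF : Irreducible F) (m : ℕ) :
    (smallSquareRoots F m).card ≤ 2 * Fintype.card K ^ m := by
  have h1 : (smallSquareRoots F m).card ≤
      2 * ((smallSquareRoots F m).image fun x => x ^ 2 % F).card := by
    refine Finset.card_le_mul_card_image _ 2 fun y hy => ?_
    obtain ⟨y, hyS, rfl⟩ := Finset.mem_image.1 hy
    refine (Finset.card_le_card (t := {y, -y}) fun x hx => ?_).trans Finset.card_le_two
    obtain ⟨hx, hxy⟩ := Finset.mem_filter.1 hx
    have h : F ∣ x ^ 2 - y ^ 2 :=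
      EuclideanDomain.mod_eq_zero.1 (by rw [Polynomial.sub_mod, sub_eq_zero.2 hxy])
    simpa using eq_or_eq_neg_of_dvd_sq_sub_sq hF (Finset.mem_filter.1 hx).1
      (Finset.mem_filter.1 hyS).1 h
  refine h1.trans (Nat.mul_le_mul_left 2 ?_)
  rw [← card_polyBall]
  refine Finset.card_le_card (Finset.image_subset_iff.2 fun x hx => ?_)
  exact mem_polyBall.2 (Finset.mem_filter.1 hx).2

/-- The elements of `smallSquareRoots F m` whose translate by `l` is there too. -/
noncomputable def smallSquareRootPairs (F : K[X]) (m : ℕ) (l : K[X]) : Finset K[X] :=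
  (smallSquareRoots F m).filter fun x => x + l ∈ smallSquareRoots F m

theorem modularRootEnergy_le_sum {F : K[X]} (hF : Irreducible F) (m : ℕ) :
    modularRootEnergy F m ≤
      ∑ l ∈ polyBall K F.natDegree, (smallSquareRootPairs F m l).card ^ 2 := by
  have h : ∑ l ∈ polyBall K F.natDegree, (smallSquareRootPairs F m l).card ^ 2 =
      ((polyBall K F.natDegree).sigma fun l =>
        smallSquareRootPairs F m l ×ˢ smallSquareRootPairs F m l).card := by
    simp [Finset.card_sigma, pow_two]
  have hmem : ∀ x ∈ modularRootQuadruples F m, ∀ i, x i ∈ smallSquareRoots F m := by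
    intro x hx i
    refine Finset.mem_filter.2 ⟨mem_polyBall.2 ?_, hx.2.1 i⟩
    rw [← degree_eq_natDegree hF.ne_zero]
    exact hx.1 i
  have hball : ∀ x ∈ modularRootQuadruples F m, ∀ i, x i ∈ polyBall K F.natDegree :=
    fun x hx i => (Finset.mem_filter.1 (hmem x hx i)).1
  have hsum : ∀ x ∈ modularRootQuadruples F m, x 0 + x 1 = x 2 + x 3 := fun x hx =>
    eq_of_dvd_sub_of_mem_polyBall hF.ne_zero (add_mem_polyBall (hball x hx 0) (hball x hx 1))
      (add_mem_polyBall (hball x hx 2) (hball x hx 3)) hx.2.2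
  rw [h, modularRootEnergy, ← Set.ncard_coe_finset]
  -- The shift is l = x₀ - x₂ = x₃ - x₁, so x₂ and x₁ both start pairs with shift l.
  refine Set.ncard_le_ncard_of_injOn
    (fun x => (⟨x 0 - x 2, (x 2, x 1)⟩ : Σ _ : K[X], K[X] × K[X])) (fun x hx => ?_) ?_
    (Finset.finite_toSet _)
  · simp only [Finset.mem_coe, Finset.mem_sigma, Finset.mem_product]
    refine ⟨sub_mem_polyBall (hball x hx 0) (hball x hx 2),
      Finset.mem_filter.2 ⟨hmem x hx 2, ?_⟩, Finset.mem_filter.2 ⟨hmem x hx 1, ?_⟩⟩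
    · simpa using hmem x hx 0
    · rw [show x 1 + (x 0 - x 2) = x 3 by linear_combination hsum x hx]
      exact hmem x hx 3
  · intro x hx y hy hxy
    have h0 := congrArg Sigma.fst hxy
    have h1 := congrArg (fun p : Σ _ : K[X], K[X] × K[X] => p.2.1) hxy
    have h2 := congrArg (fun p : Σ _ : K[X], K[X] × K[X] => p.2.2) hxy
    simp only at h0 h1 h2
    have h3 := hsum x hx
    have h4 := hsum y hy
    funext i
    fin_cases i
    · change x 0 = y 0
      linear_combination h0 + h1
    · exact h2
    · exact h1
    · change x 3 = y 3
      linear_combination h0 + h2 - h3 + h4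

theorem sum_card_smallSquareRootPairs_le (F : K[X]) (m : ℕ) :
    ∑ l ∈ polyBall K F.natDegree, (smallSquareRootPairs F m l).card ≤
      (smallSquareRoots F m).card ^ 2 := by
  rw [← Finset.card_sigma, pow_two, ← Finset.card_product]
  refine Finset.card_le_card_of_injOn (fun p => (p.2, p.2 + p.1)) (fun p hp => ?_) ?_
  · obtain ⟨-, hp⟩ := Finset.mem_sigma.1 hp
    simpa [smallSquareRootPairs] using hp
  · rintro ⟨l, x⟩ - ⟨l', x'⟩ - h
    simp only [Prod.mk.injEq] at h
    obtain ⟨rfl, h⟩ := h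
    rw [add_left_cancel h]

/-- The parabola comes from (2lx + l^2)^2 = 2l^2(2x^2 + 2lx + l^2) - l^4, and u ≡ 2lx + l^2 recovers
x because 2l is invertible modulo F. -/
theorem card_smallSquareRootPairs_le {F a c l : K[X]} (hF : Irreducible F) (h2 : (2 : K) ≠ 0)
    {m Z : ℕ} (hl : l ∈ polyBall K F.natDegree) (hl0 : l ≠ 0)
    (ha : a ≠ 0) (hc : c ≠ 0) (hac : IsCoprime a c) (hFc : ¬ F ∣ c) (hct : F ∣ c - 2 * l ^ 2 * a)
    (haZ : a.natDegree + 2 * m ≤ F.natDegree + Z) (hcZ : c.natDegree + m ≤ F.natDegree + Z) :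
    (smallSquareRootPairs F m l).card ≤ 4 * (maxDivisors K (2 * m) + 1) * Fintype.card K ^ Z ∨
      (c.natDegree < 2 * m ∧ a.natDegree < m ∧
        (smallSquareRootPairs F m l).card ^ 2 ≤ 16 * maxDivisors K (2 * m) ^ 2 *
          ∑ s ∈ (polyBall K m).erase 0 with s ^ 2 ∣ c, commonDivisorWeight m Z a c s ^ 2) := by
  have h2' : IsUnit (2 : K[X]) := by
    rw [show (2 : K[X]) = C 2 from (map_ofNat C 2).symm]
    exact isUnit_C.2 h2.isUnit
  have hFl : ¬ F ∣ l := fun h =>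
    hl0 (eq_of_dvd_sub_of_mem_polyBall hF.ne_zero hl (by simp [mem_polyBall, bot_lt_iff_ne_bot])
      (by rwa [sub_zero]))
  have hinj : Set.InjOn (fun x => (x + l) ^ 2 % F - x ^ 2 % F)
      (smallSquareRootPairs F m l : Set K[X]) := by
    intro x hx y hy hxy
    simp only at hxy
    have h1 : F ∣ 2 * (l * (x - y)) := by
      have h3 := dvd_sub (dvd_sub (dvd_mod_sub F (x ^ 2)) (dvd_mod_sub F ((x + l) ^ 2)))
        (dvd_sub (dvd_mod_sub F (y ^ 2)) (dvd_mod_sub F ((y + l) ^ 2)))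
      convert h3 using 1
      linear_combination hxy
    rw [h2'.dvd_mul_left, hF.prime.dvd_mul] at h1
    exact eq_of_dvd_sub_of_mem_polyBall hF.ne_zero
      (Finset.mem_filter.1 (Finset.mem_filter.1 hx).1).1
      (Finset.mem_filter.1 (Finset.mem_filter.1 hy).1).1 (h1.resolve_left hFl)
  rw [← Finset.card_image_of_injOn hinj]
  refine card_le_of_parabola hF h2 ha hc hac hFc hct haZ hcZ (w := l ^ 4) fun u hu => ?_
  obtain ⟨x, hx, rfl⟩ := Finset.mem_image.1 hu
  obtain ⟨hx, hxl⟩ := Finset.mem_filter.1 hx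
  have hdx := (Finset.mem_filter.1 hx).2
  have hdxl := (Finset.mem_filter.1 hxl).2
  rw [degMod] at hdx hdxl
  refine ⟨(degree_sub_le _ _).trans_lt (max_lt hdxl hdx), (x + l) ^ 2 % F + x ^ 2 % F,
    (degree_add_le _ _).trans_lt (max_lt hdxl hdx), ?_⟩
  obtain ⟨d, hd⟩ := dvd_mod_sub F (x ^ 2)
  obtain ⟨e, he⟩ := dvd_mod_sub F ((x + l) ^ 2)
  rw [eq_add_of_sub_eq hd, eq_add_of_sub_eq he]
  exact ⟨(e - d) * (2 * (2 * l * x + l ^ 2) + F * (e - d)) - 2 * l ^ 2 * (e + d), by ring⟩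

end Energy

/-! ### The energy bound, and subexponential growth of the divisor function. -/

section Asymptotic

open scoped Classical

variable {K : Type*} [Field K] [Fintype K]

theorem exists_ratio_of_mem_polyBall {F l : K[X]} (hF : Irreducible F) (h2 : (2 : K) ≠ 0) {m : ℕ}
    (hm : m ≤ F.natDegree) (hl : l ∈ polyBall K F.natDegree) (hl0 : l ≠ 0) :
    ∃ a c : K[X], a ≠ 0 ∧ c ≠ 0 ∧ IsCoprime a c ∧ ¬ F ∣ a ∧ ¬ F ∣ c ∧ F ∣ c - 2 * l ^ 2 * a ∧
      a.natDegree + 2 * m ≤ F.natDegree + (3 * m + 1 - F.natDegree) / 2 ∧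
      c.natDegree + m ≤ F.natDegree + (3 * m + 1 - F.natDegree) / 2 := by
  have hr := hF.natDegree_pos
  have h2' : IsUnit (2 : K[X]) := by
    rw [show (2 : K[X]) = C 2 from (map_ofNat C 2).symm]
    exact isUnit_C.2 h2.isUnit
  have hsmall : ∀ x : K[X], x ≠ 0 → x.natDegree < F.natDegree → ¬ F ∣ x := fun x hx0 hx h =>
    hx.not_ge (natDegree_le_of_dvd h hx0)
  have ht : ¬ F ∣ 2 * l ^ 2 := by
    rw [h2'.dvd_mul_left]
    exact fun h => hsmall l hl0 ((mem_polyBall_of_ne_zero hl0).1 hl) (hF.prime.dvd_of_dvd_pow h)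
  -- The window for c is longer by m, since a multiplies differences of degree < 2m and c
  -- differences of degree < m. The cap at deg F keeps F from dividing c.
  obtain ⟨a, c, ha, hc, hac, haA, hcC, hct⟩ := exists_isCoprime_dvd_sub_mul hF ht
    (A := (F.natDegree + 2 - m) / 2) (C := min ((F.natDegree + 2 - m) / 2 + m) F.natDegree)
    (by omega) (by omega) (by omega)
  exact ⟨a, c, ha, hc, hac, hsmall a ha (by omega), hsmall c hc (by omega), hct, by omega,
    by omega⟩

theorem modularRootEnergy_le {F : K[X]} (hF : Irreducible F) (h2 : (2 : K) ≠ 0) {m : ℕ}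
    (hm : m ≤ F.natDegree) :
    (modularRootEnergy F m : ℝ) ≤
      84 * (Fintype.card K : ℝ) ^ 4 * ((maxDivisors K (2 * m) : ℝ) + 1) ^ 2 * ((m : ℝ) + 1) ^ 3 *
        (Fintype.card K : ℝ) ^ (2 * m + (3 * m + 1 - F.natDegree) / 2) := by
  have h2' : IsUnit (2 : K[X]) := by
    rw [show (2 : K[X]) = C 2 from (map_ofNat C 2).symm]
    exact isUnit_C.2 h2.isUnit
  have hratio := fun l => exists_ratio_of_mem_polyBall (l := l) hF h2 hm
  choose! a c ha hc hac hFa hFc hct haZ hcZ using hratio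
  set Z := (3 * m + 1 - F.natDegree) / 2 with hZdef
  have hZm : Z ≤ m := by omega
  set P := fun l => (smallSquareRootPairs F m l).card with hP
  set T := maxDivisors K (2 * m) with hT
  set q : ℝ := (Fintype.card K : ℝ) with hqdef
  have hq : 1 ≤ q := by
    rw [hqdef]
    exact_mod_cast Nat.succ_le_of_lt Fintype.card_pos
  set G : K[X] × K[X] → ℝ := fun p => 16 * (T : ℝ) ^ 2 *
    ∑ s ∈ (polyBall K m).erase 0 with s ^ 2 ∣ p.2, (commonDivisorWeight m Z p.1 p.2 s : ℝ) ^ 2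
    with hG
  have hG0 : ∀ p, 0 ≤ G p := fun p =>
    mul_nonneg (by positivity) (Finset.sum_nonneg fun _ _ => sq_nonneg _)
  set Λ := ((polyBall K F.natDegree).erase 0).filter
    fun l => (c l).natDegree < 2 * m ∧ (a l).natDegree < m with hΛ
  have hpoint : ∀ l ∈ (polyBall K F.natDegree).erase 0, (P l : ℝ) ^ 2 ≤
      4 * ((T : ℝ) + 1) * q ^ Z * P l +
        if (c l).natDegree < 2 * m ∧ (a l).natDegree < m then G (a l, c l) else 0 := by
    intro l hl
    obtain ⟨hl0, hl⟩ := Finset.mem_erase.1 hl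
    rcases card_smallSquareRootPairs_le hF h2 hl hl0 (ha l hl hl0) (hc l hl hl0) (hac l hl hl0)
      (hFc l hl hl0) (hct l hl hl0) (haZ l hl hl0) (hcZ l hl hl0) with h | ⟨h3, h4, h⟩
    · have h' : (P l : ℝ) ≤ 4 * ((T : ℝ) + 1) * q ^ Z := by
        rw [hqdef]
        exact_mod_cast h
      have h'' : (P l : ℝ) ^ 2 ≤ 4 * ((T : ℝ) + 1) * q ^ Z * P l := by
        rw [pow_two]
        gcongr
      refine le_add_of_le_of_nonneg h'' ?_
      split_ifs
      · exact hG0 _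
      · exact le_rfl
    · rw [if_pos ⟨h3, h4⟩]
      refine le_add_of_nonneg_of_le (by positivity) ?_
      simp only [hG]
      exact_mod_cast h
  -- Since c ≡ 2l^2 a with a invertible modulo F, the pair (a, c) fixes l^2, hence ±l.
  have hfiber : ∀ p, (Λ.filter fun l => (a l, c l) = p).card ≤ 2 := by
    intro p
    rcases (Λ.filter fun l => (a l, c l) = p).eq_empty_or_nonempty with h | ⟨l, hl⟩
    · simp [h]
    refine (Finset.card_le_card (t := {l, -l}) fun l' hl' => ?_).trans Finset.card_le_two
    simp only [hΛ, Finset.mem_filter, Finset.mem_erase] at hl hl'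
    obtain ⟨⟨⟨hl0, hl⟩, -⟩, hlp⟩ := hl
    obtain ⟨⟨⟨hl0', hl'⟩, -⟩, hlp'⟩ := hl'
    have heq := hlp'.trans hlp.symm
    simp only [Prod.mk.injEq] at heq
    have h3 : F ∣ 2 * (a l * (l' ^ 2 - l ^ 2)) := by
      have h4 := dvd_sub (hct l hl hl0) (hct l' hl' hl0')
      rw [heq.1, heq.2] at h4
      convert h4 using 1
      ring
    rw [h2'.dvd_mul_left, hF.prime.dvd_mul] at h3
    simpa using eq_or_eq_neg_of_dvd_sq_sub_sq hF hl' hl (h3.resolve_left (hFa l hl hl0))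
  have hS := card_smallSquareRoots_le hF m
  have hPsum : ∑ l ∈ polyBall K F.natDegree, (P l : ℝ) ≤ 4 * q ^ (2 * m) := by
    have h3 := (sum_card_smallSquareRootPairs_le F m).trans (Nat.pow_le_pow_left hS 2)
    have h4 : ∑ l ∈ polyBall K F.natDegree, (P l : ℝ) ≤ (2 * q ^ m) ^ 2 := by
      rw [hqdef]
      exact_mod_cast h3
    exact h4.trans_eq (by ring)
  -- For l = 0 the parabola degenerates; the trivial bound is enough.
  have hPzero : (P 0 : ℝ) ^ 2 ≤ 4 * q ^ (2 * m) := by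
    have h3 : (P 0 : ℝ) ≤ 2 * q ^ m := by
      rw [hqdef]
      exact_mod_cast (Finset.card_le_card (Finset.filter_subset _ _)).trans hS
    calc _ ≤ (2 * q ^ m) ^ 2 := by gcongr
      _ = _ := by ring
  have hGsum : ∑ l ∈ Λ, G (a l, c l) ≤
      2 * (16 * (T : ℝ) ^ 2 * (2 * (m : ℝ) ^ 3 * q ^ (2 * m + Z + 4))) := by
    rw [Finset.sum_comp G fun l => (a l, c l)]
    have hsub : Λ.image (fun l => (a l, c l)) ⊆
        (polyBall K m).erase 0 ×ˢ (polyBall K (2 * m)).erase 0 := by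
      refine Finset.image_subset_iff.2 fun l hl => ?_
      simp only [hΛ, Finset.mem_filter, Finset.mem_erase] at hl
      obtain ⟨⟨hl0, hl⟩, h3, h4⟩ := hl
      have ha0 := ha l hl hl0
      have hc0 := hc l hl hl0
      rw [Finset.mem_product, Finset.mem_erase, Finset.mem_erase, mem_polyBall_of_ne_zero ha0,
        mem_polyBall_of_ne_zero hc0]
      exact ⟨⟨ha0, h4⟩, hc0, h3⟩
    calc _ ≤ ∑ p ∈ Λ.image (fun l => (a l, c l)), 2 * G p := by
          refine Finset.sum_le_sum fun p _ => ?_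
          rw [nsmul_eq_mul]
          exact mul_le_mul_of_nonneg_right (by exact_mod_cast hfiber p) (hG0 p)
      _ ≤ ∑ p ∈ (polyBall K m).erase 0 ×ˢ (polyBall K (2 * m)).erase 0, 2 * G p :=
          Finset.sum_le_sum_of_subset_of_nonneg hsub fun p _ _ => mul_nonneg two_pos.le (hG0 p)
      _ = 2 * (16 * (T : ℝ) ^ 2 * ∑ a ∈ (polyBall K m).erase 0,
            ∑ c ∈ (polyBall K (2 * m)).erase 0, ∑ s ∈ (polyBall K m).erase 0 with s ^ 2 ∣ c,
              (commonDivisorWeight m Z a c s : ℝ) ^ 2) := by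
          rw [Finset.sum_product]
          simp only [hG, Finset.mul_sum]
      _ ≤ _ := by
          gcongr
          exact sum_commonDivisorWeight_sq_le hZm
  have hT0 : (0 : ℝ) ≤ T := Nat.cast_nonneg T
  have hm0 : (0 : ℝ) ≤ m := Nat.cast_nonneg m
  calc (modularRootEnergy F m : ℝ) ≤ ∑ l ∈ polyBall K F.natDegree, (P l : ℝ) ^ 2 := by
        exact_mod_cast modularRootEnergy_le_sum hF m
    _ = (P 0 : ℝ) ^ 2 + ∑ l ∈ (polyBall K F.natDegree).erase 0, (P l : ℝ) ^ 2 := by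
        rw [Finset.add_sum_erase _ (fun l => (P l : ℝ) ^ 2)]
        simp [mem_polyBall, bot_lt_iff_ne_bot]
    _ ≤ 4 * q ^ (2 * m) + (4 * ((T : ℝ) + 1) * q ^ Z * (4 * q ^ (2 * m)) +
          2 * (16 * (T : ℝ) ^ 2 * (2 * (m : ℝ) ^ 3 * q ^ (2 * m + Z + 4)))) := by
        refine add_le_add hPzero ((Finset.sum_le_sum hpoint).trans ?_)
        rw [Finset.sum_add_distrib, ← Finset.mul_sum, ← Finset.sum_filter]
        refine add_le_add (mul_le_mul_of_nonneg_left ?_ (by positivity)) hGsum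
        exact (Finset.sum_le_sum_of_subset_of_nonneg (Finset.erase_subset _ _)
          fun _ _ _ => Nat.cast_nonneg _).trans hPsum
    -- The three terms are l = 0 and the two alternatives for l ≠ 0; 84 = 4 + 16 + 64.
    _ ≤ 4 * (q ^ 4 * (T + 1) ^ 2 * (m + 1) ^ 3 * q ^ (2 * m + Z)) +
          (16 * (q ^ 4 * (T + 1) ^ 2 * (m + 1) ^ 3 * q ^ (2 * m + Z)) +
            64 * (q ^ 4 * (T + 1) ^ 2 * (m + 1) ^ 3 * q ^ (2 * m + Z))) := by
        have hq4 : 1 ≤ q ^ 4 := one_le_pow₀ hq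
        have hm3 : (1 : ℝ) ≤ (m + 1) ^ 3 := one_le_pow₀ (by linarith)
        have hT1 : (T : ℝ) + 1 ≤ (T + 1) ^ 2 := by nlinarith
        have hqm : q ^ (2 * m) ≤ q ^ (2 * m + Z) := pow_le_pow_right₀ hq (by omega)
        refine add_le_add ?_ (add_le_add ?_ ?_)
        · refine mul_le_mul_of_nonneg_left ?_ (by norm_num)
          calc q ^ (2 * m) = 1 * 1 * 1 * q ^ (2 * m) := by ring
            _ ≤ _ := by
              gcongr
              linarith
        · calc _ = 16 * (1 * (T + 1) * 1 * q ^ (2 * m + Z)) := by ring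
            _ ≤ _ := by gcongr
        · calc _ = 64 * (q ^ 4 * (T : ℝ) ^ 2 * (m : ℝ) ^ 3 * q ^ (2 * m + Z)) := by ring
            _ ≤ _ := by
              gcongr <;> linarith
    _ = _ := by ring

theorem isLittleO_log_affine (k : ℕ) :
    (fun m : ℕ => Real.log ((k : ℝ) * m + 1)) =o[atTop] fun m : ℕ => (m : ℝ) := by
  rcases Nat.eq_zero_or_pos k with rfl | hk
  · simp
  have hk' : (0 : ℝ) < k := by exact_mod_cast hk
  have htend : Tendsto (fun m : ℕ => (k : ℝ) * m + 1) atTop atTop :=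
    tendsto_atTop_add_const_right _ _ (tendsto_natCast_atTop_atTop.const_mul_atTop hk')
  refine (Real.isLittleO_log_id_atTop.comp_tendsto htend).trans_isBigO ?_
  refine IsBigO.of_bound (k + 1) ?_
  filter_upwards [eventually_ge_atTop 1] with m hm
  have hm' : (1 : ℝ) ≤ m := by exact_mod_cast hm
  simp only [Function.comp_apply, id_eq]
  rw [Real.norm_of_nonneg (by positivity), Real.norm_of_nonneg (by positivity)]
  linarith

theorem isLittleO_const_natCast (x : ℝ) :
    (fun _ : ℕ => x) =o[atTop] fun m : ℕ => (m : ℝ) :=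
  isLittleO_const_left.2 (.inr (tendsto_norm_atTop_atTop.comp tendsto_natCast_atTop_atTop))

theorem isLittleO_log_maxDivisors (K : Type*) [Field K] [Fintype K] :
    (fun m : ℕ => Real.log ((maxDivisors K (2 * m) : ℝ) + 1)) =o[atTop] fun m : ℕ => (m : ℝ) := by
  rw [isLittleO_iff]
  intro ε hε
  -- Primes of degree above D then contribute at most 2m/(D+1) ≤ (ε/2)m; the other ε/2 absorbs the
  -- logarithm of a power of 2m + 1.
  obtain ⟨D, hD⟩ := exists_nat_gt (4 / ε)
  set q := Fintype.card K with hq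
  have hq0 : 0 < q := Fintype.card_pos
  have h1 : (fun m : ℕ => Real.log 2 + Real.log q + ((q ^ (D + 1) : ℕ) : ℝ) *
      Real.log (((2 : ℕ) : ℝ) * m + 1)) =o[atTop] fun m : ℕ => (m : ℝ) :=
    (isLittleO_const_natCast _).add ((isLittleO_log_affine 2).const_mul_left _)
  filter_upwards [isLittleO_iff.1 h1 (half_pos hε)] with m hm
  have hlog0 : 0 ≤ Real.log ((maxDivisors K (2 * m) : ℝ) + 1) := Real.log_nonneg (by simp)
  rw [Real.norm_of_nonneg hlog0, Real.norm_of_nonneg (Nat.cast_nonneg m)]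
  rw [Real.norm_of_nonneg (Nat.cast_nonneg m)] at hm
  replace hm := (le_abs_self _).trans hm
  have hB := maxDivisors_le (K := K) (2 * m) D
  rw [← hq] at hB
  have hB1 : 1 ≤ q * ((2 * m + 1) ^ (q ^ (D + 1)) * 2 ^ (2 * m / (D + 1))) :=
    Nat.succ_le_of_lt (by positivity)
  have hB2 : (maxDivisors K (2 * m) : ℝ) + 1 ≤
      2 * ((q : ℝ) * ((((2 : ℕ) : ℝ) * m + 1) ^ (q ^ (D + 1)) * 2 ^ (2 * m / (D + 1)))) := by
    have : maxDivisors K (2 * m) + 1 ≤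
      2 * (q * ((2 * m + 1) ^ (q ^ (D + 1)) * 2 ^ (2 * m / (D + 1)))) := by omega
    exact_mod_cast this
  have hlog := Real.log_le_log (by positivity) hB2
  have hqr : (q : ℝ) ≠ 0 := by exact_mod_cast hq0.ne'
  have hmr : ((2 : ℕ) : ℝ) * m + 1 ≠ 0 := by positivity
  rw [Real.log_mul (by positivity) (by positivity), Real.log_mul hqr (by positivity),
    Real.log_mul (by positivity) (by positivity), Real.log_pow, Real.log_pow] at hlog
  have hdiv : ((2 * m / (D + 1) : ℕ) : ℝ) * Real.log 2 ≤ ε / 2 * m := by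
    have hD0 : (0 : ℝ) < D + 1 := by positivity
    have h3 : ((2 * m / (D + 1) : ℕ) : ℝ) ≤ 2 * m / (D + 1) := by
      exact_mod_cast Nat.cast_div_le (α := ℝ) (m := 2 * m) (n := D + 1)
    have h4 : Real.log 2 ≤ 1 := by linarith [Real.log_two_lt_d9]
    have h5 : (2 : ℝ) * m / (D + 1) ≤ ε / 2 * m := by
      rw [div_le_iff₀ hD0]
      rw [div_lt_iff₀ hε] at hD
      have : (0 : ℝ) ≤ m := Nat.cast_nonneg m
      nlinarith
    calc _ ≤ ((2 * m / (D + 1) : ℕ) : ℝ) * 1 := by gcongr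
      _ ≤ _ := by linarith
  linarith

end Asymptotic

theorem theorem2p6 {K : Type*} [Field K] [Fintype K] (q : ℕ) (hq : Fintype.card K = q)
    (hodd : Odd q) :
    ∃ g : ℕ → ℝ, (g =o[atTop] fun m : ℕ => (m : ℝ)) ∧
      ∀ (F : K[X]) (r m : ℕ), Irreducible F → F.natDegree = r → m ≤ r →
        (modularRootEnergy F m : ℝ) ≤
          (q : ℝ) ^ g m *
            ((q : ℝ) ^ (7 * (m : ℝ) / 2 - (r : ℝ) / 2) + (q : ℝ) ^ (2 * (m : ℝ))) := by
  have h2 : (2 : K) ≠ 0 := by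
    refine Ring.two_ne_zero fun h => ?_
    rw [FiniteField.even_card_iff_char_two, hq] at h
    rw [Nat.odd_iff] at hodd
    omega
  have hq1 : (1 : ℝ) < q := by
    rw [← hq]
    exact_mod_cast Fintype.one_lt_card
  have hq0 : (0 : ℝ) < q := one_pos.trans hq1
  -- The fifth power of q, beyond the four in `modularRootEnergy_le`, pays for rounding in Z.
  set B : ℕ → ℝ := fun m =>
    84 * (q : ℝ) ^ 5 * ((maxDivisors K (2 * m) : ℝ) + 1) ^ 2 * ((m : ℝ) + 1) ^ 3 with hB
  have hBpos : ∀ m, 0 < B m := fun m => by positivity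
  refine ⟨fun m => Real.logb q (B m), ?_, fun F r m hF hr hm => ?_⟩
  · have h : (fun m => Real.logb q (B m)) = fun m : ℕ => (Real.log q)⁻¹ *
        (Real.log (84 * (q : ℝ) ^ 5) + 2 * Real.log ((maxDivisors K (2 * m) : ℝ) + 1) +
          3 * Real.log (((1 : ℕ) : ℝ) * m + 1)) := by
      funext m
      rw [hB, Real.logb, Real.log_mul (by positivity) (by positivity),
        Real.log_mul (by positivity) (by positivity), Real.log_pow, Real.log_pow]
      push_cast
      rw [one_mul]
      ring
    rw [h]
    exact (((isLittleO_const_natCast _).add ((isLittleO_log_maxDivisors K).const_mul_left 2)).add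
      ((isLittleO_log_affine 1).const_mul_left 3)).const_mul_left _
  · subst hr
    rw [Real.rpow_logb hq0 hq1.ne' (hBpos m)]
    have h := modularRootEnergy_le hF h2 hm
    rw [hq] at h
    have hpow : (q : ℝ) ^ (2 * m + (3 * m + 1 - F.natDegree) / 2) ≤
        q * ((q : ℝ) ^ (7 * (m : ℝ) / 2 - (F.natDegree : ℝ) / 2) + (q : ℝ) ^ (2 * (m : ℝ))) := by
      have e1 : (0 : ℝ) < (q : ℝ) ^ (7 * (m : ℝ) / 2 - (F.natDegree : ℝ) / 2) :=
        Real.rpow_pos_of_pos hq0 _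
      have e2 : (0 : ℝ) < (q : ℝ) ^ (2 * (m : ℝ)) := Real.rpow_pos_of_pos hq0 _
      rw [← Real.rpow_natCast]
      by_cases hcase : 3 * m ≤ F.natDegree
      · rw [show 2 * m + (3 * m + 1 - F.natDegree) / 2 = 2 * m by omega]
        push_cast
        nlinarith
      · have hle : ((2 * m + (3 * m + 1 - F.natDegree) / 2 : ℕ) : ℝ) ≤
            1 + (7 * (m : ℝ) / 2 - (F.natDegree : ℝ) / 2) := by
          have h3 : 2 * (2 * m + (3 * m + 1 - F.natDegree) / 2) + F.natDegree ≤ 2 + 7 * m := by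
            omega
          have h4 : (2 : ℝ) * ((2 * m + (3 * m + 1 - F.natDegree) / 2 : ℕ) : ℝ) + F.natDegree ≤
              2 + 7 * m := by exact_mod_cast h3
          linarith
        refine (Real.rpow_le_rpow_of_exponent_le hq1.le hle).trans ?_
        rw [Real.rpow_add hq0, Real.rpow_one]
        nlinarith
    calc _ ≤ _ := h
      _ ≤ 84 * (q : ℝ) ^ 4 * ((maxDivisors K (2 * m) : ℝ) + 1) ^ 2 * ((m : ℝ) + 1) ^ 3 *
          (q * ((q : ℝ) ^ (7 * (m : ℝ) / 2 - (F.natDegree : ℝ) / 2) +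
            (q : ℝ) ^ (2 * (m : ℝ)))) := by gcongr
      _ = _ := by rw [hB]; ring
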